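/- A discrete memoryless three-receiver broadcast channel has input $X$ and outputs $Y_1,Y_2,Y_3$. Receivers $Y_1,Y_2$ must decode two messages $(M_0,M_1)$ of rates $R_0,R_1\ge 0$, and receiver $Y_3$ must decode only $M_0$. All logarithms are to base $2$, and $h(x)=-x\log_2 x-(1-x)\log_2(1-x)$. The traditional inner bound for such a channel is the union, over all pairs $(U,X)$ of finite-valued random variables with $U\to X\to(Y_1,Y_2,Y_3)$ a Markov chain, of the sets of rate pairs $(R_0,R_1)$ with $$R_0\le I(U;Y_3),\quad R_1\le\min\{I(X;Y_1|U),I(X;Y_2|U)\},\quad R_0+R_1\le\min\{I(X;Y_1),I(X;Y_2)\}.$$ The traditional outer bound is the union, over all triples $(U_1,U_2,X)$ of finite-valued random variables with $(U_1,U_2)\to X\to(Y_1,Y_2,Y_3)$ a Markov chain, of the sets of rate pairs with $$R_0\le\min\{I(U_1;Y_3),I(U_2;Y_3)\},\quad R_0+R_1\le\min\{I(U_1;Y_3)+I(X;Y_1|U_1),\,I(U_2;Y_3)+I(X;Y_2|U_2)\},$$ $$R_0+R_1\le\min\{I(X;Y_1),I(X;Y_2)\}.$$ For $0\le p\le\frac12$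 consider the channels with binary alphabets $\{0,1\}$ in which $X\to(Y_1,Y_2)$ is the binary skew-symmetric broadcast channel ($X=0$ gives a uniformly distributed $Y_1$ and $Y_2=0$; $X=1$ gives $Y_1=1$ and a uniformly distributed $Y_2$) and $X\to Y_3$ is the binary symmetric channel with crossover probability $p$, the outputs being otherwise arbitrarily dependent given $X$. **Corollary.** Let $0\le p<\frac12$ with $1-h(p)<h(\frac14)-\frac12$ (that is, $p_{\max}<p<\frac12$, where $p_{\max}\approx0.184$ is the solution in $[0,\frac12]$ of $1-h(p)=h(\frac14)-\frac12$); for example, $p=\frac14$ satisfies this condition. Such channels exist, and for every one of them the inner bound is strictly contained in the outer bound. Moreover, for $0\le u\le\frac12$ put $s=\frac{1/2-u}{1-u}$. There is a triple $(U_1,U_2,X)$ with $U_1,U_2\in\{1,2\}$ and $$P(U_1=1)=P(U_2=1)=u,\qquad P(U_1=2)=P(U_2=2)=1-u,$$ $$P(X=0|U_1=1)=P(X=1|U_2=1)=1,\qquad P(X=0|U_1=2)=P(X=1|U_2=2)=s,$$ where a condition on an event of probability $0$ is void, and for every such triple the set of rate pairs satisfying the outer-bound inequalities contains all $(R_0,R_1)$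 with $R_0,R_1\ge0$ and $$R_0\le 1-(1-u)h\big(s(1-p)+(1-s)p\big)-u\,h(p),\quad R_1\le(1-u)h\big(\tfrac s2\big)-\tfrac12+u,\quad R_0+R_1\le h\big(\tfrac14\big)-\tfrac12.$$ The union of these sets over $0\le u\le\frac12$, called Region A, is therefore contained in the outer bound, but it is not contained in the inner bound. -/

import Mathlib

open scoped BigOperators

namespace DegradedBC

/-! Finite probability: `P : Ω → ℝ` is a probability mass function on the finite sample space `Ω`
(an element of `stdSimplex ℝ Ω`), and random variables are functions on `Ω`. -/

/-- The law of the random variable `A`: `law P A a` is the probability that `A = a`. -/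
def law {Ω α : Type*} [Fintype Ω] [DecidableEq α] (P : Ω → ℝ) (A : Ω → α) (a : α) : ℝ :=
  ∑ ω, if A ω = a then P ω else 0

/-- Shannon entropy `H(A)` in bits. -/
noncomputable def entropy {Ω α : Type*} [Fintype Ω] [Fintype α] [DecidableEq α]
    (P : Ω → ℝ) (A : Ω → α) : ℝ :=
  (∑ a, Real.negMulLog (law P A a)) / Real.log 2

/-- Mutual information `I(A;B) = H(A) + H(B) - H(A,B)` in bits. -/
noncomputable def mutualInfo {Ω α β : Type*} [Fintype Ω] [Fintype α] [DecidableEq α]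
    [Fintype β] [DecidableEq β] (P : Ω → ℝ) (A : Ω → α) (B : Ω → β) : ℝ :=
  entropy P A + entropy P B - entropy P (fun ω => (A ω, B ω))

/-- Conditional mutual information `I(A;B|C) = H(A,C) + H(B,C) - H(C) - H(A,B,C)` in bits. -/
noncomputable def condMutualInfo {Ω α β γ : Type*} [Fintype Ω] [Fintype α] [DecidableEq α]
    [Fintype β] [DecidableEq β] [Fintype γ] [DecidableEq γ]
    (P : Ω → ℝ) (A : Ω → α) (B : Ω → β) (C : Ω → γ) : ℝ :=
  entropy P (fun ω => (A ω, C ω)) + entropy P (fun ω => (B ω, C ω)) - entropy P C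
    - entropy P (fun ω => (A ω, B ω, C ω))

/-- The binary entropy function in bits. -/
noncomputable def h (x : ℝ) : ℝ := Real.binEntropy x / Real.log 2

section Bounds

variable {𝒳 𝒴₁ 𝒴₂ 𝒴₃ : Type*} [Fintype 𝒳] [DecidableEq 𝒳] [Fintype 𝒴₁] [DecidableEq 𝒴₁]
  [Fintype 𝒴₂] [DecidableEq 𝒴₂] [Fintype 𝒴₃] [DecidableEq 𝒴₃]

/-- `W` is the transition law of a discrete memoryless three-receiver broadcast channel:
`W x (y₁, y₂, y₃)` is the probability of the output `(y₁, y₂, y₃)` on the input `x`. -/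
def IsChannel (W : 𝒳 → 𝒴₁ × 𝒴₂ × 𝒴₃ → ℝ) : Prop :=
  ∀ x, W x ∈ stdSimplex ℝ (𝒴₁ × 𝒴₂ × 𝒴₃)

/-- The joint law of `((U, X), (Y₁, Y₂, Y₃))`, where `(U, X)` has law `q` and
`U → X → (Y₁, Y₂, Y₃)` is a Markov chain through the channel `W`. -/
def jointLaw {𝒰 : Type*} (W : 𝒳 → 𝒴₁ × 𝒴₂ × 𝒴₃ → ℝ) (q : 𝒰 × 𝒳 → ℝ) :
    (𝒰 × 𝒳) × (𝒴₁ × 𝒴₂ × 𝒴₃) → ℝ :=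
  fun ω => q ω.1 * W ω.1.2 ω.2

/-- The set of rate pairs `(R₀, R₁)` of the inner bound for one law `q` of `(U, X)`. -/
def innerRegion {𝒰 : Type*} [Fintype 𝒰] [DecidableEq 𝒰]
    (W : 𝒳 → 𝒴₁ × 𝒴₂ × 𝒴₃ → ℝ) (q : 𝒰 × 𝒳 → ℝ) : Set (ℝ × ℝ) :=
  let P := jointLaw W q
  let U := fun ω : (𝒰 × 𝒳) × (𝒴₁ × 𝒴₂ × 𝒴₃) => ω.1.1
  let X := fun ω : (𝒰 × 𝒳) × (𝒴₁ × 𝒴₂ × 𝒴₃) => ω.1.2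
  let Y₁ := fun ω : (𝒰 × 𝒳) × (𝒴₁ × 𝒴₂ × 𝒴₃) => ω.2.1
  let Y₂ := fun ω : (𝒰 × 𝒳) × (𝒴₁ × 𝒴₂ × 𝒴₃) => ω.2.2.1
  let Y₃ := fun ω : (𝒰 × 𝒳) × (𝒴₁ × 𝒴₂ × 𝒴₃) => ω.2.2.2
  {R | 0 ≤ R.1 ∧ 0 ≤ R.2 ∧
    R.1 ≤ mutualInfo P U Y₃ ∧
    R.2 ≤ min (condMutualInfo P X Y₁ U) (condMutualInfo P X Y₂ U) ∧
    R.1 + R.2 ≤ min (mutualInfo P X Y₁) (mutualInfo P X Y₂)}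

/-- The traditional inner bound: the union over all `(U, X)` with `U` of finite alphabet. -/
def innerBound (W : 𝒳 → 𝒴₁ × 𝒴₂ × 𝒴₃ → ℝ) : Set (ℝ × ℝ) :=
  {R | ∃ (m : ℕ) (q : Fin m × 𝒳 → ℝ), q ∈ stdSimplex ℝ (Fin m × 𝒳) ∧ R ∈ innerRegion W q}

/-- The set of rate pairs `(R₀, R₁)` of the outer bound for one law `q` of `((U₁, U₂), X)`. -/
def outerRegion {𝒰₁ 𝒰₂ : Type*} [Fintype 𝒰₁] [DecidableEq 𝒰₁] [Fintype 𝒰₂] [DecidableEq 𝒰₂]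
    (W : 𝒳 → 𝒴₁ × 𝒴₂ × 𝒴₃ → ℝ) (q : (𝒰₁ × 𝒰₂) × 𝒳 → ℝ) : Set (ℝ × ℝ) :=
  let P := jointLaw W q
  let U₁ := fun ω : ((𝒰₁ × 𝒰₂) × 𝒳) × (𝒴₁ × 𝒴₂ × 𝒴₃) => ω.1.1.1
  let U₂ := fun ω : ((𝒰₁ × 𝒰₂) × 𝒳) × (𝒴₁ × 𝒴₂ × 𝒴₃) => ω.1.1.2
  let X := fun ω : ((𝒰₁ × 𝒰₂) × 𝒳) × (𝒴₁ × 𝒴₂ × 𝒴₃) => ω.1.2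
  let Y₁ := fun ω : ((𝒰₁ × 𝒰₂) × 𝒳) × (𝒴₁ × 𝒴₂ × 𝒴₃) => ω.2.1
  let Y₂ := fun ω : ((𝒰₁ × 𝒰₂) × 𝒳) × (𝒴₁ × 𝒴₂ × 𝒴₃) => ω.2.2.1
  let Y₃ := fun ω : ((𝒰₁ × 𝒰₂) × 𝒳) × (𝒴₁ × 𝒴₂ × 𝒴₃) => ω.2.2.2
  {R | 0 ≤ R.1 ∧ 0 ≤ R.2 ∧
    R.1 ≤ min (mutualInfo P U₁ Y₃) (mutualInfo P U₂ Y₃) ∧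
    R.1 + R.2 ≤ min (mutualInfo P U₁ Y₃ + condMutualInfo P X Y₁ U₁)
      (mutualInfo P U₂ Y₃ + condMutualInfo P X Y₂ U₂) ∧
    R.1 + R.2 ≤ min (mutualInfo P X Y₁) (mutualInfo P X Y₂)}

/-- The traditional outer bound: the union over all `(U₁, U₂, X)` with `U₁`, `U₂` of finite
alphabet. -/
def outerBound (W : 𝒳 → 𝒴₁ × 𝒴₂ × 𝒴₃ → ℝ) : Set (ℝ × ℝ) :=
  {R | ∃ (m n : ℕ) (q : (Fin m × Fin n) × 𝒳 → ℝ),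
    q ∈ stdSimplex ℝ ((Fin m × Fin n) × 𝒳) ∧ R ∈ outerRegion W q}

end Bounds

/-- The skew-symmetric channel `X → Y₁`: input `0` gives a fair bit, input `1` gives `1`. -/
noncomputable def skewOne (x y : Fin 2) : ℝ := if x = 0 then 1 / 2 else if y = 1 then 1 else 0

/-- The skew-symmetric channel `X → Y₂`: input `1` gives a fair bit, input `0` gives `0`. -/
noncomputable def skewTwo (x y : Fin 2) : ℝ := if x = 1 then 1 / 2 else if y = 0 then 1 else 0

/-- The binary symmetric channel with crossover probability `p`. -/
def bsc (p : ℝ) (x y : Fin 2) : ℝ := if y = x then 1 - p else p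

/-- A three-receiver broadcast channel with binary alphabets for which `X → (Y₁, Y₂)` is the binary
skew-symmetric broadcast channel and `X → Y₃` is the binary symmetric channel with crossover
probability `p`. The dependence between the three outputs given the input is arbitrary. -/
structure IsSkewSymmetricBSC (p : ℝ) (W : Fin 2 → Fin 2 × Fin 2 × Fin 2 → ℝ) : Prop where
  isChannel : IsChannel W
  fst : ∀ x y₁, ∑ y₂, ∑ y₃, W x (y₁, y₂, y₃) = skewOne x y₁
  snd : ∀ x y₂, ∑ y₁, ∑ y₃, W x (y₁, y₂, y₃) = skewTwo x y₂
  trd : ∀ x y₃, ∑ y₁, ∑ y₂, W x (y₁, y₂, y₃) = bsc p x y₃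

/-- The parameter `s = (1/2 - u) / (1 - u)`. -/
noncomputable def sParam (u : ℝ) : ℝ := (1 / 2 - u) / (1 - u)

/-- `q` is a law of `((U₁, U₂), X)` with `P(U₁=0) = P(U₂=0) = u`, `P(U₁=1) = P(U₂=1) = 1 - u`,
`P(X=0|U₁=0) = P(X=1|U₂=0) = 1`, `P(X=0|U₁=1) = P(X=1|U₂=1) = s` with `s = (1/2 - u) / (1 - u)`,
written through the joint laws of `(U₁, X)` and `(U₂, X)`. -/
structure IsChoice (u : ℝ) (q : (Fin 2 × Fin 2) × Fin 2 → ℝ) : Prop where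
  mem : q ∈ stdSimplex ℝ ((Fin 2 × Fin 2) × Fin 2)
  one_00 : law q (fun ω => (ω.1.1, ω.2)) (0, 0) = u
  one_01 : law q (fun ω => (ω.1.1, ω.2)) (0, 1) = 0
  one_10 : law q (fun ω => (ω.1.1, ω.2)) (1, 0) = (1 - u) * sParam u
  one_11 : law q (fun ω => (ω.1.1, ω.2)) (1, 1) = (1 - u) * (1 - sParam u)
  two_00 : law q (fun ω => (ω.1.2, ω.2)) (0, 0) = 0
  two_01 : law q (fun ω => (ω.1.2, ω.2)) (0, 1) = u
  two_10 : law q (fun ω => (ω.1.2, ω.2)) (1, 0) = (1 - u) * (1 - sParam u)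
  two_11 : law q (fun ω => (ω.1.2, ω.2)) (1, 1) = (1 - u) * sParam u

/-- The part of Region A that belongs to the parameter `u`. -/
def regionAAt (p u : ℝ) : Set (ℝ × ℝ) :=
  {R | 0 ≤ R.1 ∧ 0 ≤ R.2 ∧
    R.1 ≤ 1 - (1 - u) * h (sParam u * (1 - p) + (1 - sParam u) * p) - u * h p ∧
    R.2 ≤ (1 - u) * h (sParam u / 2) - 1 / 2 + u ∧
    R.1 + R.2 ≤ h (1 / 4) - 1 / 2}

/-- Region A: the union over `0 ≤ u ≤ 1/2`. -/
def regionA (p : ℝ) : Set (ℝ × ℝ) := ⋃ u ∈ Set.Icc (0 : ℝ) (1 / 2), regionAAt p u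

end DegradedBC

namespace DegradedBC

/-! ### Reduction of informations to a canonical sample space -/

section Law

variable {Ω τ α β γ : Type*} [Fintype Ω] [Fintype τ] [DecidableEq τ] [Fintype α] [DecidableEq α]
  [Fintype β] [DecidableEq β] [Fintype γ] [DecidableEq γ]

/-! Region A lies in the outer bound by direct computation; that it leaves the inner bound comes
from comparing exponentially small gains of `L * R₀ + R₁` as `L → ∞`. Measure in nats, let `x` be
the conditional probability of `X = 0`, let `H(x * p)` be the entropy of `Y₃` at that `x`, and let
`c = bscSlope p` be its slope at `x = 0`. Deterministic `X` given a uniform auxiliary is the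
baseline.

In the inner bound one `U` serves both receivers, so `R₁` is at most the mean of two conditional
informations. Near `x = 0` only `Y₁` gains, to leading order `(x / 2) * log (1 / x)`; the mean keeps
half of it against a cost near `L * c * x`, and the best net gain has order `exp (-4 * L * c)`. The
proof settles for `exp (-3 * L * c) / 2` (`exists_lagrangian_le`, fed into `innerBound_le`).

In Region A each receiver has its own auxiliary and keeps the whole gain on mass `1 - u ≥ 1/2` at
the same unit cost, so the net gain is at least of order `s = exp (-(2 * L * c + 1))`, which wins
for large `L` (`not_regionA_subset`). As `s → 0` the corner tends to `(1 - h p, 0)`, and `1 - h p <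
h (1/4) - 1/2` keeps the sum-rate constraint slack there. -/

lemma law_comp {σ : Type*} [DecidableEq σ] (P : Ω → ℝ) (T : Ω → τ) (g : τ → σ) :
    law P (fun ω => g (T ω)) = law (law P T) g := by
  funext a
  unfold law
  have : ∀ t, (if g t = a then ∑ ω, (if T ω = t then P ω else 0) else 0)
      = ∑ ω, if T ω = t then (if g t = a then P ω else 0) else 0 := by
    intro t
    split_ifs <;> simp
  simp only [this]
  rw [Finset.sum_comm]
  simp

lemma entropy_comp (P : Ω → ℝ) (T : Ω → τ) (g : τ → α) :
    entropy P (fun ω => g (T ω)) = entropy (law P T) g := by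
  unfold entropy
  rw [law_comp P T g]

lemma mutualInfo_comp (P : Ω → ℝ) (T : Ω → τ) (f : τ → α) (g : τ → β) :
    mutualInfo P (fun ω => f (T ω)) (fun ω => g (T ω)) = mutualInfo (law P T) f g := by
  unfold mutualInfo
  rw [entropy_comp P T f, entropy_comp P T g, entropy_comp P T (fun t => (f t, g t))]

lemma condMutualInfo_comp (P : Ω → ℝ) (T : Ω → τ) (f : τ → α) (g : τ → β) (k : τ → γ) :
    condMutualInfo P (fun ω => f (T ω)) (fun ω => g (T ω)) (fun ω => k (T ω))
      = condMutualInfo (law P T) f g k := by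
  unfold condMutualInfo
  rw [entropy_comp P T k, entropy_comp P T (fun t => (f t, k t)),
    entropy_comp P T (fun t => (g t, k t)), entropy_comp P T (fun t => (f t, g t, k t))]

end Law

/-! ### Entropy formulas for a chain with binary input and output -/

section Chain

variable {𝒰 α : Type*} [Fintype 𝒰] [Fintype α] [DecidableEq α]

/-- The law of `(A, X, Y)` when `(A, X)` has law `r` and `Y` is the output of the channel `K`. -/
def chainLaw {σ : Type*} (r : σ × Fin 2 → ℝ) (K : Fin 2 → Fin 2 → ℝ) : σ × Fin 2 × Fin 2 → ℝ :=
  fun t => r (t.1, t.2.1) * K t.2.1 t.2.2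

/-- The channel sees the first factor only through `X`, so the double sum splits into a product.
Since `A` is arbitrary, this covers `U`, `U₁`, `U₂` and `X` itself as auxiliaries. -/
lemma law_jointLaw {σ : Type*} [DecidableEq σ]
    {𝒴₁ 𝒴₂ 𝒴₃ : Type*} [Fintype 𝒴₁] [Fintype 𝒴₂] [Fintype 𝒴₃]
    (W : Fin 2 → 𝒴₁ × 𝒴₂ × 𝒴₃ → ℝ) (q : 𝒰 × Fin 2 → ℝ) (A : 𝒰 × Fin 2 → σ)
    (Y : 𝒴₁ × 𝒴₂ × 𝒴₃ → Fin 2) (K : Fin 2 → Fin 2 → ℝ) (hK : ∀ x y, law (W x) Y y = K x y) :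
    law (jointLaw W q) (fun ω => (A ω.1, ω.1.2, Y ω.2))
      = chainLaw (law q fun c => (A c, c.2)) K := by
  funext ⟨a, x, y⟩
  simp only [chainLaw, ← hK]
  unfold law jointLaw
  rw [Fintype.sum_prod_type, Finset.sum_mul_sum]
  refine Finset.sum_congr rfl fun c _ => Finset.sum_congr rfl fun z _ => ?_
  by_cases h1 : A c = a <;> by_cases h2 : c.2 = x <;> by_cases h3 : Y z = y <;>
    simp [h1, h2, h3]

/-- The entropy of a pair of masses relative to their sum, in nats. -/
noncomputable def pairEntropy (a b : ℝ) : ℝ :=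
  Real.negMulLog a + Real.negMulLog b - Real.negMulLog (a + b)

lemma pairEntropy_comm (a b : ℝ) : pairEntropy a b = pairEntropy b a := by
  unfold pairEntropy
  rw [add_comm b a]
  ring

/-- Homogeneity of degree one: masses can be used without normalizing, so auxiliary values of
probability zero need no separate case. -/
lemma pairEntropy_mul (w x : ℝ) : pairEntropy (w * x) (w * (1 - x)) = w * Real.binEntropy x := by
  unfold pairEntropy
  rw [show w * x + w * (1 - x) = w by ring, Real.negMulLog_mul, Real.negMulLog_mul,
    Real.binEntropy_eq_negMulLog_add_negMulLog_one_sub]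
  ring

lemma chainLaw_mass {σ : Type*} (r : σ × Fin 2 → ℝ) {K : Fin 2 → Fin 2 → ℝ}
    (hK : ∀ x, K x 0 + K x 1 = 1) (a : σ) :
    (r (a, 0) * K 0 0 + r (a, 1) * K 1 0) + (r (a, 0) * K 0 1 + r (a, 1) * K 1 1)
      = r (a, 0) + r (a, 1) := by
  linear_combination r (a, 0) * hK 0 + r (a, 1) * hK 1

lemma law_chainLaw_fst (r : α × Fin 2 → ℝ) {K : Fin 2 → Fin 2 → ℝ}
    (hK : ∀ x, K x 0 + K x 1 = 1) (a : α) :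
    law (chainLaw r K) (fun t => t.1) a = r (a, 0) + r (a, 1) := by
  rw [← chainLaw_mass r hK]
  simp [law, chainLaw, Fintype.sum_prod_type]
  ring

/-- This is `H(Y) - H(Y|A)`; total mass one removes the normalizing term of `H(Y)`. -/
lemma mutualInfo_chainLaw (r : α × Fin 2 → ℝ) (K : Fin 2 → Fin 2 → ℝ)
    (hK : ∀ x, K x 0 + K x 1 = 1) (hr : ∑ a, (r (a, 0) + r (a, 1)) = 1) :
    mutualInfo (chainLaw r K) (fun t => t.1) (fun t => t.2.2) * Real.log 2
      = pairEntropy (∑ a, (r (a, 0) * K 0 0 + r (a, 1) * K 1 0))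
          (∑ a, (r (a, 0) * K 0 1 + r (a, 1) * K 1 1))
        - ∑ a, pairEntropy (r (a, 0) * K 0 0 + r (a, 1) * K 1 0)
            (r (a, 0) * K 0 1 + r (a, 1) * K 1 1) := by
  have hl : Real.log 2 ≠ 0 := (Real.log_pos one_lt_two).ne'
  have h2 : ∀ y, law (chainLaw r K) (fun t => t.2.2) y
      = ∑ a, (r (a, 0) * K 0 y + r (a, 1) * K 1 y) := by
    intro y
    simp [law, chainLaw, Fintype.sum_prod_type]
  have h3 : ∀ a y, law (chainLaw r K) (fun t => (t.1, t.2.2)) (a, y)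
      = r (a, 0) * K 0 y + r (a, 1) * K 1 y := by
    intro a y
    simp only [law, chainLaw, Fintype.sum_prod_type, Prod.mk.injEq, ite_and]
    simp [Finset.sum_ite_irrel]
  have h4 : ∑ a, (r (a, 0) * K 0 0 + r (a, 1) * K 1 0)
      + ∑ a, (r (a, 0) * K 0 1 + r (a, 1) * K 1 1) = 1 := by
    rw [← hr, ← Finset.sum_add_distrib]
    exact Finset.sum_congr rfl fun a _ => chainLaw_mass r hK a
  unfold mutualInfo entropy
  rw [← add_div, ← sub_div, div_mul_cancel₀ _ hl, Fintype.sum_prod_type]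
  simp only [law_chainLaw_fst r hK, h2, h3, pairEntropy, h4, chainLaw_mass r hK, Fin.sum_univ_two,
    Real.negMulLog_one]
  rw [Finset.sum_sub_distrib]
  ring

/-- This is `H(Y|A) - H(Y|X,A)`, where the Markov property reduces the last term to `H(Y|X)`. -/
lemma condMutualInfo_chainLaw (r : α × Fin 2 → ℝ) (K : Fin 2 → Fin 2 → ℝ)
    (hK : ∀ x, K x 0 + K x 1 = 1) :
    condMutualInfo (chainLaw r K) (fun t => t.2.1) (fun t => t.2.2) (fun t => t.1) * Real.log 2
      = ∑ a, (pairEntropy (r (a, 0) * K 0 0 + r (a, 1) * K 1 0)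
            (r (a, 0) * K 0 1 + r (a, 1) * K 1 1)
          - r (a, 0) * pairEntropy (K 0 0) (K 0 1) - r (a, 1) * pairEntropy (K 1 0) (K 1 1)) := by
  have hl : Real.log 2 ≠ 0 := (Real.log_pos one_lt_two).ne'
  have h2 : ∀ x a, law (chainLaw r K) (fun t => (t.2.1, t.1)) (x, a) = r (a, x) := by
    intro x a
    simp only [law, chainLaw, Fintype.sum_prod_type, Prod.mk.injEq, ite_and]
    fin_cases x <;> simp [← mul_add, hK]
  have h3 : ∀ y a, law (chainLaw r K) (fun t => (t.2.2, t.1)) (y, a)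
      = r (a, 0) * K 0 y + r (a, 1) * K 1 y := by
    intro y a
    simp only [law, chainLaw, Fintype.sum_prod_type, Prod.mk.injEq, ite_and]
    simp [Finset.sum_ite_irrel]
  have h4 : ∀ x y a, law (chainLaw r K) (fun t => (t.2.1, t.2.2, t.1)) (x, y, a)
      = r (a, x) * K x y := by
    intro x y a
    simp only [law, chainLaw, Fintype.sum_prod_type, Prod.mk.injEq, ite_and]
    fin_cases x <;> fin_cases y <;> simp
  -- The chain rule for `(X, Y)` at a fixed value of `A`.
  have h6 : ∀ x a, Real.negMulLog (r (a, x) * K x 0) + Real.negMulLog (r (a, x) * K x 1)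
      = Real.negMulLog (r (a, x)) + r (a, x) * pairEntropy (K x 0) (K x 1) := by
    intro x a
    rw [pairEntropy, hK, Real.negMulLog_mul, Real.negMulLog_mul, Real.negMulLog_one]
    linear_combination Real.negMulLog (r (a, x)) * hK x
  unfold condMutualInfo entropy
  rw [← add_div, ← sub_div, ← sub_div, div_mul_cancel₀ _ hl]
  simp only [Fintype.sum_prod_type, law_chainLaw_fst r hK, h2, h3, h4, Fin.sum_univ_two,
    ← Finset.sum_add_distrib, ← Finset.sum_sub_distrib]
  refine Finset.sum_congr rfl fun a _ => ?_
  rw [pairEntropy, chainLaw_mass r hK]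
  linear_combination -h6 0 a - h6 1 a

end Chain

/-! ### Informations across the skew-symmetric channel -/

section Joint

variable {𝒰 α : Type*} [Fintype 𝒰] [Fintype α] [DecidableEq α]
  {𝒴₁ 𝒴₂ 𝒴₃ : Type*} [Fintype 𝒴₁] [Fintype 𝒴₂] [Fintype 𝒴₃]

lemma mutualInfo_jointLaw (W : Fin 2 → 𝒴₁ × 𝒴₂ × 𝒴₃ → ℝ) (q : 𝒰 × Fin 2 → ℝ)
    (A : 𝒰 × Fin 2 → α) (Y : 𝒴₁ × 𝒴₂ × 𝒴₃ → Fin 2) {K : Fin 2 → Fin 2 → ℝ}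
    (hK : ∀ x y, law (W x) Y y = K x y) :
    mutualInfo (jointLaw W q) (fun ω => A ω.1) (fun ω => Y ω.2)
      = mutualInfo (chainLaw (law q fun c => (A c, c.2)) K) (fun t => t.1) (fun t => t.2.2) := by
  rw [← law_jointLaw W q A Y K hK]
  exact mutualInfo_comp _ (fun ω : (𝒰 × Fin 2) × 𝒴₁ × 𝒴₂ × 𝒴₃ => (A ω.1, ω.1.2, Y ω.2))
    (fun t => t.1) (fun t => t.2.2)

lemma condMutualInfo_jointLaw (W : Fin 2 → 𝒴₁ × 𝒴₂ × 𝒴₃ → ℝ) (q : 𝒰 × Fin 2 → ℝ)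
    (A : 𝒰 × Fin 2 → α) (Y : 𝒴₁ × 𝒴₂ × 𝒴₃ → Fin 2) {K : Fin 2 → Fin 2 → ℝ}
    (hK : ∀ x y, law (W x) Y y = K x y) :
    condMutualInfo (jointLaw W q) (fun ω => ω.1.2) (fun ω => Y ω.2) (fun ω => A ω.1)
      = condMutualInfo (chainLaw (law q fun c => (A c, c.2)) K)
          (fun t => t.2.1) (fun t => t.2.2) (fun t => t.1) := by
  rw [← law_jointLaw W q A Y K hK]
  exact condMutualInfo_comp _ (fun ω : (𝒰 × Fin 2) × 𝒴₁ × 𝒴₂ × 𝒴₃ => (A ω.1, ω.1.2, Y ω.2))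
    (fun t => t.2.1) (fun t => t.2.2) (fun t => t.1)

lemma law_id {Ω : Type*} [Fintype Ω] [DecidableEq Ω] (q : Ω → ℝ) : law q (fun c => c) = q := by
  funext c
  simp [law]

end Joint

lemma pairEntropy_half : pairEntropy (1 / 2) (1 / 2) = Real.log 2 := by
  have := pairEntropy_mul 1 (1 / 2)
  norm_num at this
  simpa using this

lemma pairEntropy_zero_one : pairEntropy 0 1 = 0 := by simp [pairEntropy]

lemma pairEntropy_one_zero : pairEntropy 1 0 = 0 := by simp [pairEntropy]

lemma pairEntropy_eq_binEntropy {a b : ℝ} (hab : a + b = 1) :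
    pairEntropy a b = Real.binEntropy a := by
  have := pairEntropy_mul 1 a
  rwa [one_mul, one_mul, one_mul, show 1 - a = b by linarith] at this

lemma skewOne_sum (x : Fin 2) : skewOne x 0 + skewOne x 1 = 1 := by
  fin_cases x <;> norm_num [skewOne]

lemma skewTwo_sum (x : Fin 2) : skewTwo x 0 + skewTwo x 1 = 1 := by
  fin_cases x <;> norm_num [skewTwo]

lemma bsc_sum (p : ℝ) (x : Fin 2) : bsc p x 0 + bsc p x 1 = 1 := by
  fin_cases x <;> simp [bsc]

section Skew

variable {p : ℝ} {W : Fin 2 → Fin 2 × Fin 2 × Fin 2 → ℝ}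

lemma IsSkewSymmetricBSC.law_fst (hW : IsSkewSymmetricBSC p W) (x y : Fin 2) :
    law (W x) (fun z => z.1) y = skewOne x y := by
  rw [← hW.fst]
  fin_cases y <;> simp [law, Fintype.sum_prod_type]

lemma IsSkewSymmetricBSC.law_snd (hW : IsSkewSymmetricBSC p W) (x y : Fin 2) :
    law (W x) (fun z => z.2.1) y = skewTwo x y := by
  rw [← hW.snd]
  fin_cases y <;> simp [law, Fintype.sum_prod_type]

lemma IsSkewSymmetricBSC.law_trd (hW : IsSkewSymmetricBSC p W) (x y : Fin 2) :
    law (W x) (fun z => z.2.2) y = bsc p x y := by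
  rw [← hW.trd]
  fin_cases y <;> simp [law, Fintype.sum_prod_type]

variable {𝒰 α : Type*} [Fintype 𝒰] [Fintype α] [DecidableEq α]

lemma sum_law {Ω : Type*} [Fintype Ω] (q : Ω → ℝ) (A : Ω → α) : ∑ a, law q A a = ∑ c, q c := by
  unfold law
  rw [Finset.sum_comm]
  simp

lemma IsSkewSymmetricBSC.mutualInfo_trd (hW : IsSkewSymmetricBSC p W) {q : 𝒰 × Fin 2 → ℝ}
    (hq : ∑ c, q c = 1) (A : 𝒰 × Fin 2 → α) {r : α × Fin 2 → ℝ}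
    (hr : (law q fun c => (A c, c.2)) = r) :
    mutualInfo (jointLaw W q) (fun ω => A ω.1) (fun ω => ω.2.2.2) * Real.log 2
      = pairEntropy (∑ a, (r (a, 0) * (1 - p) + r (a, 1) * p))
          (∑ a, (r (a, 0) * p + r (a, 1) * (1 - p)))
        - ∑ a, pairEntropy (r (a, 0) * (1 - p) + r (a, 1) * p)
            (r (a, 0) * p + r (a, 1) * (1 - p)) := by
  have hs : ∑ a, (r (a, 0) + r (a, 1)) = 1 := by
    rw [← hq, ← sum_law q fun c => (A c, c.2), hr, Fintype.sum_prod_type]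
    simp
  have h1 := mutualInfo_jointLaw W q A (fun z => z.2.2) hW.law_trd
  rw [h1, hr, mutualInfo_chainLaw r _ (bsc_sum p) hs]
  simp [bsc]

/-- Only input `0` is noisy for `Y₁`, so `H(Y₁|X)` is `log 2` times the mass of `X = 0`. -/
lemma IsSkewSymmetricBSC.condMutualInfo_fst (hW : IsSkewSymmetricBSC p W) {q : 𝒰 × Fin 2 → ℝ}
    (A : 𝒰 × Fin 2 → α) {r : α × Fin 2 → ℝ} (hr : (law q fun c => (A c, c.2)) = r) :
    condMutualInfo (jointLaw W q) (fun ω => ω.1.2) (fun ω => ω.2.1) (fun ω => A ω.1) * Real.log 2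
      = ∑ a, (pairEntropy (r (a, 0) * (1 / 2)) (r (a, 0) * (1 / 2) + r (a, 1))
          - r (a, 0) * Real.log 2) := by
  have h1 := condMutualInfo_jointLaw W q A (fun z => z.1) hW.law_fst
  rw [h1, hr, condMutualInfo_chainLaw r _ skewOne_sum]
  have h2 := pairEntropy_half
  simp only [one_div] at h2
  simp [skewOne, h2, pairEntropy_zero_one]

lemma IsSkewSymmetricBSC.condMutualInfo_snd (hW : IsSkewSymmetricBSC p W) {q : 𝒰 × Fin 2 → ℝ}
    (A : 𝒰 × Fin 2 → α) {r : α × Fin 2 → ℝ} (hr : (law q fun c => (A c, c.2)) = r) :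
    condMutualInfo (jointLaw W q) (fun ω => ω.1.2) (fun ω => ω.2.2.1) (fun ω => A ω.1) * Real.log 2
      = ∑ a, (pairEntropy (r (a, 0) + r (a, 1) * (1 / 2)) (r (a, 1) * (1 / 2))
          - r (a, 1) * Real.log 2) := by
  have h1 := condMutualInfo_jointLaw W q A (fun z => z.2.1) hW.law_snd
  rw [h1, hr, condMutualInfo_chainLaw r _ skewTwo_sum]
  have h2 := pairEntropy_half
  simp only [one_div] at h2
  simp [skewTwo, h2, pairEntropy_one_zero]

/-! ### The inner bound -/

/-- Writing a pair of masses as a total mass and a conditional probability. -/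
lemma exists_mass_prob {a b : ℝ} (ha : 0 ≤ a) (hb : 0 ≤ b) :
    ∃ x ∈ Set.Icc (0 : ℝ) 1, a = (a + b) * x ∧ b = (a + b) * (1 - x) := by
  rcases (add_nonneg ha hb).eq_or_lt with h0 | h0
  · exact ⟨0, by simp, by linarith, by linarith⟩
  · refine ⟨a / (a + b), ⟨by positivity, (div_le_one h0).2 (by linarith)⟩, ?_, ?_⟩
    · field_simp
    · field_simp
      ring

/-- A Lagrangian bound for the inner bound: conditionally on `U`, with `x` the conditional
probability of `X = 0`, the rates are averages of `log 2 - H(x * p)` and at most the mean of the two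
skew-symmetric informations. -/
lemma IsSkewSymmetricBSC.innerBound_le (hW : IsSkewSymmetricBSC p W) {L M : ℝ} (hL : 0 ≤ L)
    (hM : ∀ x ∈ Set.Icc (0 : ℝ) 1,
      (Real.binEntropy (x / 2) + Real.binEntropy ((1 - x) / 2) - Real.log 2) / 2
        - L * Real.binEntropy (x * (1 - p) + (1 - x) * p) ≤ M)
    {R : ℝ × ℝ} (hR : R ∈ innerBound W) :
    (L * R.1 + R.2) * Real.log 2 ≤ L * Real.log 2 + M := by
  obtain ⟨m, q, ⟨hq0, hq1⟩, -, -, h0, h1, -⟩ := hR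
  have hl : 0 < Real.log 2 := Real.log_pos one_lt_two
  have hr : (law q fun c => (c.1, c.2)) = q := law_id q
  have e0 := hW.mutualInfo_trd hq1 (fun c => c.1) hr
  have e1 := hW.condMutualInfo_fst (fun c => c.1) hr
  have e2 := hW.condMutualInfo_snd (fun c => c.1) hr
  have hs : ∑ a, (q (a, 0) + q (a, 1)) = 1 := by
    rw [← hq1, Fintype.sum_prod_type]
    simp
  have b0 : R.1 * Real.log 2 ≤ _ := mul_le_mul_of_nonneg_right h0 hl.le
  have b1 : R.2 * Real.log 2 ≤ _ := mul_le_mul_of_nonneg_right (h1.trans (min_le_left _ _)) hl.le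
  have b2 : R.2 * Real.log 2 ≤ _ := mul_le_mul_of_nonneg_right (h1.trans (min_le_right _ _)) hl.le
  rw [e0, pairEntropy_eq_binEntropy] at b0
  swap
  · rw [← Finset.sum_add_distrib]
    exact (Finset.sum_congr rfl fun a _ => by ring).trans hs
  rw [e1] at b1
  rw [e2] at b2
  -- Bounding `H(Y₃)` by `log 2` removes the only term that is not a sum over the values of `U`; the
  -- rest is an average of pointwise bounds.
  have b0' := b0.trans (sub_le_sub_right Real.binEntropy_le_log_two _)
  have key : ∀ a, ((pairEntropy (q (a, 0) * (1 / 2)) (q (a, 0) * (1 / 2) + q (a, 1))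
          - q (a, 0) * Real.log 2) + (pairEntropy (q (a, 0) + q (a, 1) * (1 / 2))
          (q (a, 1) * (1 / 2)) - q (a, 1) * Real.log 2)) / 2
        - L * pairEntropy (q (a, 0) * (1 - p) + q (a, 1) * p)
            (q (a, 0) * p + q (a, 1) * (1 - p)) ≤ (q (a, 0) + q (a, 1)) * M := by
    intro a
    obtain ⟨x, hx, ha, hb⟩ := exists_mass_prob (hq0 (a, 0)) (hq0 (a, 1))
    have hw : 0 ≤ q (a, 0) + q (a, 1) := add_nonneg (hq0 _) (hq0 _)
    generalize q (a, 0) + q (a, 1) = w at *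
    rw [ha, hb]
    have i1 := pairEntropy_mul w (x / 2)
    have i2 := pairEntropy_mul w ((1 - x) / 2)
    have i3 := pairEntropy_mul w (x * (1 - p) + (1 - x) * p)
    rw [pairEntropy_comm] at i2
    rw [show w * x * (1 / 2) = w * (x / 2) by ring,
      show w * (x / 2) + w * (1 - x) = w * (1 - x / 2) by ring,
      show w * (1 - x) * (1 / 2) = w * ((1 - x) / 2) by ring,
      show w * x + w * ((1 - x) / 2) = w * (1 - (1 - x) / 2) by ring,
      show w * x * (1 - p) + w * (1 - x) * p = w * (x * (1 - p) + (1 - x) * p) by ring,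
      show w * x * p + w * (1 - x) * (1 - p) = w * (1 - (x * (1 - p) + (1 - x) * p)) by ring,
      i1, i2, i3]
    have := mul_le_mul_of_nonneg_left (hM x hx) hw
    linarith
  have ksum := Finset.sum_le_sum fun a (_ : a ∈ Finset.univ) => key a
  rw [Finset.sum_sub_distrib, ← Finset.sum_div, Finset.sum_add_distrib, ← Finset.mul_sum,
    ← Finset.sum_mul, hs, one_mul] at ksum
  have b0'' := mul_le_mul_of_nonneg_left b0' hL
  linarith

end Skew

/-! ### The outer bound -/

/-- Take `U₁ = U₂ = U`: the law is carried by the diagonal, and the mixed sum-rate constraints are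
sums of the two individual ones. -/
lemma innerBound_subset_outerBound (W : Fin 2 → Fin 2 × Fin 2 × Fin 2 → ℝ) :
    innerBound W ⊆ outerBound W := by
  rintro R ⟨m, q, ⟨hq0, hq1⟩, hR0, hR1, h0, h1, h2⟩
  set q' : (Fin m × Fin m) × Fin 2 → ℝ :=
    fun c => if c.1.1 = c.1.2 then q (c.1.1, c.2) else 0 with hq'
  have l1 : (law q' fun c => (c.1.1, c.2)) = q := by
    funext ⟨a, x⟩
    fin_cases x <;> simp [law, hq', Fintype.sum_prod_type, ite_and]
  have l2 : (law q' fun c => (c.1.2, c.2)) = q := by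
    funext ⟨a, x⟩
    fin_cases x <;> simp [law, hq', Fintype.sum_prod_type, ite_and]
  have l3 : (law q' fun c => (c.2, c.2)) = law q fun c => (c.2, c.2) := by
    conv_rhs => rw [← l1]
    exact law_comp q' (fun c => (c.1.1, c.2)) fun c => (c.2, c.2)
  have l0 : (law q fun c => (c.1, c.2)) = q := law_id q
  have i3 := mutualInfo_jointLaw W q (fun c => c.1) (fun z => z.2.2) fun _ _ => rfl
  have j1 := mutualInfo_jointLaw W q' (fun c => c.1.1) (fun z => z.2.2) fun _ _ => rfl
  have j2 := mutualInfo_jointLaw W q' (fun c => c.1.2) (fun z => z.2.2) fun _ _ => rfl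
  have c1 := condMutualInfo_jointLaw W q (fun c => c.1) (fun z => z.1) fun _ _ => rfl
  have c2 := condMutualInfo_jointLaw W q (fun c => c.1) (fun z => z.2.1) fun _ _ => rfl
  have d1 := condMutualInfo_jointLaw W q' (fun c => c.1.1) (fun z => z.1) fun _ _ => rfl
  have d2 := condMutualInfo_jointLaw W q' (fun c => c.1.2) (fun z => z.2.1) fun _ _ => rfl
  have x1 := mutualInfo_jointLaw W q (fun c => c.2) (fun z => z.1) fun _ _ => rfl
  have x2 := mutualInfo_jointLaw W q (fun c => c.2) (fun z => z.2.1) fun _ _ => rfl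
  have y1 := mutualInfo_jointLaw W q' (fun c => c.2) (fun z => z.1) fun _ _ => rfl
  have y2 := mutualInfo_jointLaw W q' (fun c => c.2) (fun z => z.2.1) fun _ _ => rfl
  rw [l0] at i3 c1 c2
  rw [l1] at j1 d1
  rw [l2] at j2 d2
  rw [l3] at y1 y2
  refine ⟨m, m, q', ⟨fun c => ?_, ?_⟩, hR0, hR1, ?_, ?_, ?_⟩
  · simp only [hq']
    split_ifs
    exacts [hq0 _, le_rfl]
  · rw [← sum_law q' fun c => (c.1.1, c.2), l1, hq1]
  · rw [j1, j2, ← i3, min_self]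
    exact h0
  · rw [j1, j2, d1, d2, ← i3, ← c1, ← c2]
    exact le_min (add_le_add h0 (h1.trans (min_le_left _ _)))
      (add_le_add h0 (h1.trans (min_le_right _ _)))
  · rw [y1, y2, ← x1, ← x2]
    exact h2

/-! ### Existence of the channels and of the auxiliary laws -/

lemma exists_isSkewSymmetricBSC {p : ℝ} (hp0 : 0 ≤ p) (hp1 : p ≤ 1) :
    ∃ W : Fin 2 → Fin 2 × Fin 2 × Fin 2 → ℝ, IsSkewSymmetricBSC p W := by
  have h1 := skewOne_sum
  have h2 := skewTwo_sum
  have h3 := bsc_sum p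
  -- The outputs are taken conditionally independent given the input.
  refine ⟨fun x z => skewOne x z.1 * skewTwo x z.2.1 * bsc p x z.2.2, ⟨fun x => ⟨fun z => ?_, ?_⟩,
    fun x y => ?_, fun x y => ?_, fun x y => ?_⟩⟩
  · refine mul_nonneg (mul_nonneg ?_ ?_) ?_
    · unfold skewOne
      split_ifs <;> norm_num
    · unfold skewTwo
      split_ifs <;> norm_num
    · unfold bsc
      split_ifs <;> linarith
  · simp only [Fintype.sum_prod_type, ← Finset.mul_sum, Fin.sum_univ_two, h3, mul_one, h2, h1]
  · simp only [← Finset.mul_sum, Fin.sum_univ_two, h3, mul_one, h2]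
  · simp only [← Finset.mul_sum, Fin.sum_univ_two, h3, mul_one, ← add_mul, h1, one_mul]
  · simp only [Fin.sum_univ_two, ← add_mul, ← mul_add, h2, h1, one_mul]

lemma one_sub_mul_sParam {u : ℝ} (hu : u ≤ 1 / 2) : (1 - u) * sParam u = 1 / 2 - u := by
  unfold sParam
  rw [mul_div_cancel₀]
  linarith

lemma exists_isChoice {u : ℝ} (hu0 : 0 ≤ u) (hu1 : u ≤ 1 / 2) : ∃ q, IsChoice u q := by
  have hs := one_sub_mul_sParam hu1
  have hs' : (1 - u) * (1 - sParam u) = 1 / 2 := by linarith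
  -- `U₁ = 0` forces `X = 0` and `U₂ = 0` forces `X = 1`, so these events are made disjoint, each of
  -- mass `u`; on `U₁ = U₂ = 1` both inputs get the remaining `1/2 - u`.
  refine ⟨fun c => if c.1 = (1, 1) then 1 / 2 - u else if c = ((0, 1), 0) then u else
    if c = ((1, 0), 1) then u else 0, ⟨⟨fun c => ?_, ?_⟩, ?_, ?_, ?_, ?_, ?_, ?_, ?_, ?_⟩⟩
  · dsimp only
    split_ifs <;> linarith
  · simp [Fintype.sum_prod_type]
    ring
  all_goals simp [law, Fintype.sum_prod_type, hs, hs']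

lemma binEntropy_half : Real.binEntropy (1 / 2) = Real.log 2 := by
  rw [one_div, Real.binEntropy_two_inv]

/-! ### Region A inside the outer bound -/

section Skew

variable {p : ℝ} {W : Fin 2 → Fin 2 × Fin 2 × Fin 2 → ℝ} {𝒰 : Type*} [Fintype 𝒰]

lemma IsSkewSymmetricBSC.mutualInfo_fst (hW : IsSkewSymmetricBSC p W) {q : 𝒰 × Fin 2 → ℝ}
    (hq0 : law q (fun c => c.2) 0 = 1 / 2) (hq1 : law q (fun c => c.2) 1 = 1 / 2) :
    mutualInfo (jointLaw W q) (fun ω => ω.1.2) (fun ω => ω.2.1) * Real.log 2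
      = Real.binEntropy (1 / 4) - Real.log 2 / 2 := by
  have h1 := mutualInfo_jointLaw W q (fun c => c.2) (fun z => z.1) hW.law_fst
  -- `X` plays the auxiliary as well, so the pair law sits on the diagonal of `(X, X)`.
  have hl := law_comp q (fun c => c.2) (fun x => (x, x))
  have a2 := pairEntropy_zero_one
  have a3 := pairEntropy_mul (1 / 2) (1 / 2)
  have a4 := pairEntropy_mul 1 (1 / 4)
  have a5 := pairEntropy_mul (1 / 2) 0
  have e00 : law (law q fun c => c.2) (fun x => (x, x)) (0, 0) = 1 / 2 := by simp [law, ← hq0]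
  have e01 : law (law q fun c => c.2) (fun x => (x, x)) (0, 1) = 0 := by simp [law]
  have e10 : law (law q fun c => c.2) (fun x => (x, x)) (1, 0) = 0 := by simp [law]
  have e11 : law (law q fun c => c.2) (fun x => (x, x)) (1, 1) = 1 / 2 := by simp [law, ← hq1]
  rw [h1, hl, mutualInfo_chainLaw _ _ skewOne_sum]
  · simp only [Fin.sum_univ_two, e00, e01, e10, e11]
    norm_num [skewOne] at a2 a3 a4 a5 ⊢
    rw [a4, a3, a5, binEntropy_half]
    ring
  · simp only [Fin.sum_univ_two, e00, e01, e10, e11]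
    norm_num

lemma IsSkewSymmetricBSC.mutualInfo_snd (hW : IsSkewSymmetricBSC p W) {q : 𝒰 × Fin 2 → ℝ}
    (hq0 : law q (fun c => c.2) 0 = 1 / 2) (hq1 : law q (fun c => c.2) 1 = 1 / 2) :
    mutualInfo (jointLaw W q) (fun ω => ω.1.2) (fun ω => ω.2.2.1) * Real.log 2
      = Real.binEntropy (1 / 4) - Real.log 2 / 2 := by
  have h1 := mutualInfo_jointLaw W q (fun c => c.2) (fun z => z.2.1) hW.law_snd
  have hl := law_comp q (fun c => c.2) (fun x => (x, x))
  have a3 := pairEntropy_mul (1 / 2) (1 / 2)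
  have a4 := pairEntropy_mul 1 (1 / 4)
  rw [pairEntropy_comm] at a4
  have a5 := pairEntropy_mul (1 / 2) 1
  have e00 : law (law q fun c => c.2) (fun x => (x, x)) (0, 0) = 1 / 2 := by simp [law, ← hq0]
  have e01 : law (law q fun c => c.2) (fun x => (x, x)) (0, 1) = 0 := by simp [law]
  have e10 : law (law q fun c => c.2) (fun x => (x, x)) (1, 0) = 0 := by simp [law]
  have e11 : law (law q fun c => c.2) (fun x => (x, x)) (1, 1) = 1 / 2 := by simp [law, ← hq1]
  rw [h1, hl, mutualInfo_chainLaw _ _ skewTwo_sum]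
  · simp only [Fin.sum_univ_two, e00, e01, e10, e11]
    norm_num [skewTwo] at a3 a4 a5 ⊢
    rw [a4, a3, a5, binEntropy_half]
    ring
  · simp only [Fin.sum_univ_two, e00, e01, e10, e11]
    norm_num

/-- Exchanging the input symbols swaps the roles of `(U₁, Y₁)` and `(U₂, Y₂)`, so the two entries of
every minimum agree. `X` is uniform, hence so is `Y₃`. -/
lemma IsSkewSymmetricBSC.regionAAt_subset (hW : IsSkewSymmetricBSC p W) {u : ℝ} (hu1 : u ≤ 1 / 2)
    {q : (Fin 2 × Fin 2) × Fin 2 → ℝ} (hq : IsChoice u q) : regionAAt p u ⊆ outerRegion W q := by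
  have hs := one_sub_mul_sParam hu1
  have hl : 0 < Real.log 2 := Real.log_pos one_lt_two
  obtain ⟨⟨hq0, hq1⟩, h00, h01, h10, h11, k00, k01, k10, k11⟩ := hq
  rintro R ⟨hR0, hR1, h0, h1, h2⟩
  generalize sParam u = s at *
  have x0 : law q (fun c => c.2) 0 = 1 / 2 := by
    have := congrFun (law_comp q (fun c => (c.1.1, c.2)) fun t => t.2) 0
    rw [this]
    unfold law at h00 h10 ⊢
    simp [Fintype.sum_prod_type] at h00 h10 ⊢
    linarith
  have x1 : law q (fun c => c.2) 1 = 1 / 2 := by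
    have := congrFun (law_comp q (fun c => (c.1.1, c.2)) fun t => t.2) 1
    rw [this]
    unfold law at h01 h11 ⊢
    simp [Fintype.sum_prod_type] at h01 h11 ⊢
    linarith
  have m1 := hW.mutualInfo_fst x0 x1
  have m2 := hW.mutualInfo_snd x0 x1
  have t1 := hW.mutualInfo_trd hq1 (fun c => c.1.1) rfl
  have t2 := hW.mutualInfo_trd hq1 (fun c => c.1.2) rfl
  have c1 := hW.condMutualInfo_fst (q := q) (fun c => c.1.1) rfl
  have c2 := hW.condMutualInfo_snd (q := q) (fun c => c.1.2) rfl
  simp only [Fin.sum_univ_two, h00, h01, h10, h11, k00, k01, k10, k11] at t1 t2 c1 c2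
  have hhalf := pairEntropy_half
  have a1 := pairEntropy_mul u p
  have a2 := pairEntropy_mul (1 - u) (s * (1 - p) + (1 - s) * p)
  have a3 := pairEntropy_mul (1 - u) (s / 2)
  have a4 := pairEntropy_mul u (1 / 2)
  rw [binEntropy_half] at a4
  have T1 : mutualInfo (jointLaw W q) (fun ω => ω.1.1.1) (fun ω => ω.2.2.2) * Real.log 2
      = Real.log 2 - (1 - u) * Real.binEntropy (s * (1 - p) + (1 - s) * p)
        - u * Real.binEntropy p := by
    rw [t1, ← hhalf, ← a1, ← a2, pairEntropy_comm (u * p),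
      show u * (1 - p) + 0 * p + ((1 - u) * s * (1 - p) + (1 - u) * (1 - s) * p) = 1 / 2 by
        linear_combination (1 - 2 * p) * hs,
      show u * p + 0 * (1 - p) + ((1 - u) * s * p + (1 - u) * (1 - s) * (1 - p)) = 1 / 2 by
        linear_combination (2 * p - 1) * hs,
      show u * (1 - p) + 0 * p = u * (1 - p) by ring,
      show u * p + 0 * (1 - p) = u * p by ring,
      show (1 - u) * s * (1 - p) + (1 - u) * (1 - s) * p
        = (1 - u) * (s * (1 - p) + (1 - s) * p) by ring,
      show (1 - u) * s * p + (1 - u) * (1 - s) * (1 - p)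
        = (1 - u) * (1 - (s * (1 - p) + (1 - s) * p)) by ring]
    ring
  have T2 : mutualInfo (jointLaw W q) (fun ω => ω.1.1.2) (fun ω => ω.2.2.2) * Real.log 2
      = Real.log 2 - (1 - u) * Real.binEntropy (s * (1 - p) + (1 - s) * p)
        - u * Real.binEntropy p := by
    rw [t2, ← hhalf, ← a1, ← a2,
      pairEntropy_comm ((1 - u) * (s * (1 - p) + (1 - s) * p)),
      show 0 * (1 - p) + u * p + ((1 - u) * (1 - s) * (1 - p) + (1 - u) * s * p) = 1 / 2 by
        linear_combination (2 * p - 1) * hs,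
      show 0 * p + u * (1 - p) + ((1 - u) * (1 - s) * p + (1 - u) * s * (1 - p)) = 1 / 2 by
        linear_combination (1 - 2 * p) * hs,
      show 0 * (1 - p) + u * p = u * p by ring,
      show 0 * p + u * (1 - p) = u * (1 - p) by ring,
      show (1 - u) * (1 - s) * (1 - p) + (1 - u) * s * p
        = (1 - u) * (1 - (s * (1 - p) + (1 - s) * p)) by ring,
      show (1 - u) * (1 - s) * p + (1 - u) * s * (1 - p)
        = (1 - u) * (s * (1 - p) + (1 - s) * p) by ring]
    ring
  have C1 : condMutualInfo (jointLaw W q) (fun ω => ω.1.2) (fun ω => ω.2.1) (fun ω => ω.1.1.1)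
      * Real.log 2 = (1 - u) * Real.binEntropy (s / 2) - Real.log 2 / 2 + u * Real.log 2 := by
    rw [c1, show u * (1 / 2) + 0 = u * (1 - 1 / 2) by ring, a4,
      show (1 - u) * s * (1 / 2) = (1 - u) * (s / 2) by ring,
      show (1 - u) * (s / 2) + (1 - u) * (1 - s) = (1 - u) * (1 - s / 2) by ring, a3]
    linear_combination -Real.log 2 * hs
  have C2 : condMutualInfo (jointLaw W q) (fun ω => ω.1.2) (fun ω => ω.2.2.1) (fun ω => ω.1.1.2)
      * Real.log 2 = (1 - u) * Real.binEntropy (s / 2) - Real.log 2 / 2 + u * Real.log 2 := by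
    rw [c2, show 0 + u * (1 / 2) = u * (1 - 1 / 2) by ring, pairEntropy_comm (u * (1 - 1 / 2)), a4,
      show (1 - u) * s * (1 / 2) = (1 - u) * (s / 2) by ring,
      show (1 - u) * (1 - s) + (1 - u) * (s / 2) = (1 - u) * (1 - s / 2) by ring,
      pairEntropy_comm ((1 - u) * (1 - s / 2)), a3]
    linear_combination -Real.log 2 * hs
  have hb : ∀ x, h x * Real.log 2 = Real.binEntropy x := fun x => div_mul_cancel₀ _ hl.ne'
  have T : 1 - (1 - u) * h (s * (1 - p) + (1 - s) * p) - u * h p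
      = mutualInfo (jointLaw W q) (fun ω => ω.1.1.1) (fun ω => ω.2.2.2) := by
    refine mul_right_cancel₀ hl.ne' ?_
    rw [T1, ← hb, ← hb]
    ring
  have C : (1 - u) * h (s / 2) - 1 / 2 + u = condMutualInfo (jointLaw W q) (fun ω => ω.1.2)
      (fun ω => ω.2.1) (fun ω => ω.1.1.1) := by
    refine mul_right_cancel₀ hl.ne' ?_
    rw [C1, ← hb]
    ring
  have S : h (1 / 4) - 1 / 2 = mutualInfo (jointLaw W q) (fun ω => ω.1.2) (fun ω => ω.2.1) := by
    refine mul_right_cancel₀ hl.ne' ?_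
    rw [m1, ← hb]
    ring
  have T' := mul_right_cancel₀ hl.ne' (T1.trans T2.symm)
  have C' := mul_right_cancel₀ hl.ne' (C1.trans C2.symm)
  have S' := mul_right_cancel₀ hl.ne' (m1.trans m2.symm)
  rw [T] at h0
  rw [C] at h1
  rw [S] at h2
  refine ⟨hR0, hR1, ?_, ?_, ?_⟩
  · rw [← T', min_self]
    exact h0
  · rw [← T', ← C', min_self]
    exact add_le_add h0 h1
  · rw [← S', min_self]
    exact h2

end Skew

/-! ### Entropy estimates -/

lemma mul_neg_log_le_binEntropy {y : ℝ} (hy0 : 0 ≤ y) (hy1 : y < 1) :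
    y * -Real.log y ≤ Real.binEntropy y := by
  unfold Real.binEntropy
  rw [Real.log_inv, Real.log_inv]
  have : Real.log (1 - y) ≤ 0 := Real.log_nonpos (by linarith) (by linarith)
  nlinarith

/-- `log t ≤ t - 1` at `t = 1 / (1 - y)` bounds the second entropy term by `y`. -/
lemma binEntropy_le_mul_one_sub_log {y : ℝ} (hy1 : y < 1) :
    Real.binEntropy y ≤ y * (1 - Real.log y) := by
  unfold Real.binEntropy
  have h1 : 0 < 1 - y := by linarith
  have h2 := mul_le_mul_of_nonneg_left (Real.log_le_sub_one_of_pos (inv_pos.2 h1)) h1.le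
  rw [mul_sub, mul_inv_cancel₀ h1.ne'] at h2
  rw [Real.log_inv y]
  linarith

/-- The left side is maximal at `x = exp (a - 1)`; apply `log t ≤ t - 1` to `t = exp (a - 1) / x`.
-/
lemma mul_const_sub_log_le_exp {x : ℝ} (hx : 0 < x) (a : ℝ) :
    x * (a - Real.log x) ≤ Real.exp (a - 1) := by
  have h1 := Real.log_le_sub_one_of_pos (div_pos (Real.exp_pos (a - 1)) hx)
  rw [Real.log_div (Real.exp_pos _).ne' hx.ne', Real.log_exp] at h1
  have h2 := mul_le_mul_of_nonneg_left h1 hx.le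
  rw [mul_sub x (_ / _), mul_div_cancel₀ _ hx.ne'] at h2
  linarith

/-! ### Entropy across the binary symmetric channel, and the Lagrangian -/

section Slope

variable {p : ℝ}

/-- The derivative at `x = 0` of the output entropy `H(x * p)` of the binary symmetric channel. -/
noncomputable def bscSlope (p : ℝ) : ℝ := (1 - 2 * p) * (Real.log (1 - p) - Real.log p)

lemma bscSlope_pos (hp0 : 0 < p) (hp1 : p < 1 / 2) : 0 < bscSlope p :=
  mul_pos (by linarith) (sub_pos.2 (Real.log_lt_log hp0 (by linarith)))

lemma hasDerivAt_bscEntropy (hp0 : 0 < p) (hp1 : p < 1 / 2) :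
    HasDerivAt (fun x => Real.binEntropy (x * (1 - p) + (1 - x) * p)) (bscSlope p) 0 := by
  have h1 : HasDerivAt (fun x : ℝ => x * (1 - p) + (1 - x) * p) (1 - 2 * p) 0 := by
    have := ((hasDerivAt_id (0 : ℝ)).mul_const (1 - 2 * p)).add_const p
    rw [one_mul] at this
    rwa [show (fun x : ℝ => x * (1 - p) + (1 - x) * p) = fun x => id x * (1 - 2 * p) + p by
      funext x
      rw [id]
      ring]
  have h2 : HasDerivAt Real.binEntropy (Real.log (1 - p) - Real.log p)
      ((0 : ℝ) * (1 - p) + (1 - 0) * p) := by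
    rw [show (0 : ℝ) * (1 - p) + (1 - 0) * p = p by ring]
    exact Real.hasDerivAt_binEntropy hp0.ne' (by linarith)
  have := h2.comp (0 : ℝ) h1
  rw [mul_comm] at this
  exact this

lemma bscEntropy_mono (hp0 : 0 < p) (hp1 : p < 1 / 2) :
    MonotoneOn (fun x => Real.binEntropy (x * (1 - p) + (1 - x) * p)) (Set.Icc 0 (1 / 2)) := by
  intro x hx y hy hxy
  have hmem : ∀ z ∈ Set.Icc (0 : ℝ) (1 / 2), z * (1 - p) + (1 - z) * p ∈ Set.Icc 0 (2⁻¹ : ℝ) := by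
    rintro z ⟨hz0, hz1⟩
    constructor <;> nlinarith
  exact Real.binEntropy_strictMonoOn.monotoneOn (hmem x hx) (hmem y hy) (by nlinarith)

/-- Concavity puts the graph below its tangent at `p`; this caps the cost of the Region A point. -/
lemma bscEntropy_le (hp0 : 0 < p) (hp1 : p < 1 / 2) {x : ℝ} (hx0 : 0 ≤ x) (hx1 : x ≤ 1) :
    Real.binEntropy (x * (1 - p) + (1 - x) * p) ≤ Real.binEntropy p + bscSlope p * x := by
  rcases hx0.eq_or_lt with rfl | hx0
  · simp
  have hc : ConcaveOn ℝ (Set.Icc 0 1) Real.binEntropy := Real.strictConcave_binEntropy.concaveOn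
  have hlt : p < x * (1 - p) + (1 - x) * p := by nlinarith
  have := hc.slope_le_of_hasDerivAt (x := p) (y := x * (1 - p) + (1 - x) * p)
    ⟨hp0.le, by linarith⟩ ⟨by linarith, by nlinarith⟩ hlt
    (Real.hasDerivAt_binEntropy hp0.ne' (by linarith))
  rw [slope_def_field, div_le_iff₀ (by linarith)] at this
  unfold bscSlope
  nlinarith

/-- The factor `3/4` leads to the exponent `4 * (3/4) = 3`; any factor strictly between `1/2` and
`1` would still beat the exponent `2` of Region A. -/
lemma exists_bscEntropy_ge (hp0 : 0 < p) (hp1 : p < 1 / 2) :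
    ∃ δ > 0, δ ≤ 1 / 2 ∧ ∀ x ∈ Set.Icc 0 δ, Real.binEntropy p + 3 / 4 * bscSlope p * x
      ≤ Real.binEntropy (x * (1 - p) + (1 - x) * p) := by
  have hc := bscSlope_pos hp0 hp1
  have h1 := (hasDerivAt_bscEntropy hp0 hp1).tendsto_slope.eventually
    (lt_mem_nhds (show 3 / 4 * bscSlope p < bscSlope p by linarith))
  rw [eventually_nhdsWithin_iff, Metric.eventually_nhds_iff] at h1
  obtain ⟨ε, hε, h2⟩ := h1
  refine ⟨min (ε / 2) (1 / 2), by positivity, min_le_right _ _, ?_⟩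
  rintro x ⟨hx0, hx1⟩
  rcases hx0.eq_or_lt with rfl | hx0
  · simp
  have h3 := h2 (y := x) (by
    rw [Real.dist_eq, sub_zero, abs_of_pos hx0]
    linarith [min_le_left (ε / 2) (1 / 2 : ℝ)]) hx0.ne'
  rw [slope_def_field, lt_div_iff₀ (by linarith)] at h3
  simp only [zero_mul, sub_zero, one_mul, zero_add] at h3
  linarith

/-- For a large multiplier the symmetrized Lagrangian is at most its value at `x = 0` up to an
exponentially small term. -/
lemma exists_lagrangian_le (hp0 : 0 < p) (hp1 : p < 1 / 2) :
    ∃ L₀, ∀ L ≥ L₀, 0 ≤ L → ∀ x ∈ Set.Icc (0 : ℝ) 1,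
      (Real.binEntropy (x / 2) + Real.binEntropy ((1 - x) / 2) - Real.log 2) / 2
        - L * Real.binEntropy (x * (1 - p) + (1 - x) * p)
      ≤ -(L * Real.binEntropy p) + Real.exp (-(3 * L * bscSlope p)) / 2 := by
  obtain ⟨δ, hδ0, hδ1, hδ⟩ := exists_bscEntropy_ge hp0 hp1
  have hc := bscSlope_pos hp0 hp1
  -- For such `L` the cost at `x = δ` is at least `log 2`, more than any possible gain; monotonicity
  -- extends this to `[δ, 1/2]`.
  refine ⟨Real.log 2 / (3 / 4 * bscSlope p * δ), fun L hL hL0 => ?_⟩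
  rw [ge_iff_le, div_le_iff₀ (by positivity)] at hL
  have hl : 0 < Real.log 2 := Real.log_pos one_lt_two
  have main : ∀ x ∈ Set.Icc (0 : ℝ) (1 / 2),
      (Real.binEntropy (x / 2) + Real.binEntropy ((1 - x) / 2) - Real.log 2) / 2
        - L * Real.binEntropy (x * (1 - p) + (1 - x) * p)
      ≤ -(L * Real.binEntropy p) + Real.exp (-(3 * L * bscSlope p)) / 2 := by
    rintro x ⟨hx0, hx1⟩
    have hE := Real.exp_pos (-(3 * L * bscSlope p))
    have g1 : Real.binEntropy ((1 - x) / 2) ≤ Real.log 2 := Real.binEntropy_le_log_two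
    have g2 : Real.binEntropy (x / 2) ≤ Real.log 2 := Real.binEntropy_le_log_two
    rcases le_total x δ with hxδ | hxδ
    · have hD := mul_le_mul_of_nonneg_left (hδ x ⟨hx0, hxδ⟩) hL0
      rcases hx0.eq_or_lt with rfl | hx0
      · simp only [zero_div, Real.binEntropy_zero] at *
        linarith
      have g3 := binEntropy_le_mul_one_sub_log (y := x / 2) (by linarith)
      rw [Real.log_div hx0.ne' two_ne_zero] at g3
      -- Here `H(x/2) / 2 ≤ (x / 4) * (log 2 + 1 - log x)`, and the cost `(3/4) * L * c * x` enters
      -- the bracket as `3 * L * c`.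
      have g4 := mul_const_sub_log_le_exp hx0 (Real.log 2 + 1 - 3 * L * bscSlope p)
      rw [show Real.log 2 + 1 - 3 * L * bscSlope p - 1 = Real.log 2 + -(3 * L * bscSlope p) by ring,
        Real.exp_add, Real.exp_log two_pos] at g4
      linarith
    · have hD := hδ δ ⟨hδ0.le, le_rfl⟩
      have hm := bscEntropy_mono hp0 hp1 (a := δ) (b := x) ⟨hδ0.le, hδ1⟩ ⟨hx0, hx1⟩ hxδ
      have hD' := mul_le_mul_of_nonneg_left (hD.trans hm) hL0
      simp only at hD'
      linarith
  rintro x ⟨hx0, hx1⟩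
  rcases le_total x (1 / 2) with hx | hx
  · exact main x ⟨hx0, hx⟩
  · have := main (1 - x) ⟨by linarith, by linarith⟩
    rw [sub_sub_cancel, ← Real.binEntropy_one_sub ((1 - x) * _ + _),
      show 1 - ((1 - x) * (1 - p) + x * p) = x * (1 - p) + (1 - x) * p by ring] at this
    linarith

end Slope

/-! ### A point of Region A beyond the inner bound -/

open Filter Topology in
lemma IsSkewSymmetricBSC.not_regionA_subset {p : ℝ} (hp0 : 0 < p) (hp1 : p < 1 / 2)
    (hp : 1 - h p < h (1 / 4) - 1 / 2) {W : Fin 2 → Fin 2 × Fin 2 × Fin 2 → ℝ}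
    (hW : IsSkewSymmetricBSC p W) : ¬ regionA p ⊆ innerBound W := by
  intro hsub
  have hl : 0 < Real.log 2 := Real.log_pos one_lt_two
  have hl1 : Real.log 2 < 1 := Real.log_two_lt_d9.trans (by norm_num)
  have hb : ∀ x, h x * Real.log 2 = Real.binEntropy x := fun x => div_mul_cancel₀ _ hl.ne'
  have hc := bscSlope_pos hp0 hp1
  obtain ⟨L₀, hL₀⟩ := exists_lagrangian_le hp0 hp1
  have hgap : 0 < (h (1 / 4) - 1 / 2 - (1 - h p)) * Real.log 2 := mul_pos (by linarith) hl
  have hexp : Tendsto (fun L : ℝ => Real.exp (L * bscSlope p)) atTop atTop :=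
    Real.tendsto_exp_atTop.comp (tendsto_id.atTop_mul_const hc)
  have hs0 : Tendsto (fun L : ℝ => Real.exp (-(2 * L * bscSlope p + 1))) atTop (𝓝 0) := by
    refine Real.tendsto_exp_neg_atTop_nhds_zero.comp (tendsto_atTop_add_const_right _ _ ?_)
    exact (tendsto_id.const_mul_atTop two_pos).atTop_mul_const hc
  have hH0 : Tendsto (fun L : ℝ => Real.binEntropy (Real.exp (-(2 * L * bscSlope p + 1)) / 2))
      atTop (𝓝 0) := by
    have := (Real.binEntropy_continuous.tendsto (0 / 2)).comp (hs0.div_const 2)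
    rwa [zero_div, Real.binEntropy_zero] at this
  obtain ⟨L, hLL, hL0, hE, hs1, hH⟩ := ((eventually_ge_atTop L₀).and <|
    (eventually_ge_atTop 0).and <|
    (hexp.eventually_gt_atTop (2 * Real.exp 1 / (1 - Real.log 2))).and <|
    (hs0.eventually_le_const (show (0 : ℝ) < 1 / 2 by norm_num)).and <|
    hH0.eventually_le_const hgap).exists
  have hLag := hL₀ L hLL hL0
  -- `s` maximizes `-(s * log s) / 2 - L * c * s`, the leading part of the gain with `c = bscSlope
  -- p`.
  set s := Real.exp (-(2 * L * bscSlope p + 1)) with hs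
  have hspos : 0 < s := Real.exp_pos _
  -- The map `u ↦ (1/2 - u) / (1 - u)` is an involution, so this `u` has `sParam u = s`.
  obtain ⟨u, hu⟩ : ∃ u, u = (1 / 2 - s) / (1 - s) := ⟨_, rfl⟩
  have h1s : 0 < 1 - s := by linarith
  have hu' : 1 - u = 1 / 2 / (1 - s) := by
    rw [hu]
    field_simp
    ring
  have hu0 : 0 ≤ u := by
    rw [hu]
    exact div_nonneg (by linarith) h1s.le
  have hu1 : 1 / 2 ≤ 1 - u := by
    rw [hu', le_div_iff₀ h1s]
    linarith
  have hus : (1 - u) * s = 1 / 2 - u := by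
    have : (1 - u) * (1 - s) = 1 / 2 := by
      rw [hu', div_mul_cancel₀ _ h1s.ne']
    linarith
  have hsP : sParam u = s := by
    rw [sParam, ← hus, mul_div_cancel_left₀]
    linarith
  set A := 1 - (1 - u) * h (s * (1 - p) + (1 - s) * p) - u * h p with hA
  set B := (1 - u) * h (s / 2) - 1 / 2 + u with hB
  have hA' : A * Real.log 2 = Real.log 2
      - (1 - u) * Real.binEntropy (s * (1 - p) + (1 - s) * p) - u * Real.binEntropy p := by
    rw [hA, ← hb, ← hb]
    ring
  have hB' : B * Real.log 2 = (1 - u) * (Real.binEntropy (s / 2) - s * Real.log 2) := by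
    rw [hB, ← hb]
    linear_combination Real.log 2 * hus
  have hlow : s * (L * bscSlope p) + s * ((1 - Real.log 2) / 2)
      ≤ Real.binEntropy (s / 2) - s * Real.log 2 := by
    have := mul_neg_log_le_binEntropy (y := s / 2) (by positivity) (by linarith)
    rw [Real.log_div hspos.ne' two_ne_zero, hs, Real.log_exp, ← hs] at this
    linarith
  have hDhi := bscEntropy_le hp0 hp1 hspos.le (by linarith)
  have hDlo := bscEntropy_mono hp0 hp1 (a := 0) (b := s) ⟨le_rfl, by norm_num⟩ ⟨hspos.le, hs1⟩
    hspos.le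
  simp only [zero_mul, sub_zero, one_mul, zero_add] at hDlo
  have hmem : (A, B) ∈ regionA p := by
    refine Set.mem_iUnion₂.2 ⟨u, ⟨hu0, by linarith⟩, ?_⟩
    unfold regionAAt
    rw [hsP]
    refine ⟨?_, ?_, le_rfl, le_rfl, ?_⟩
    · refine nonneg_of_mul_nonneg_left (b := Real.log 2) ?_ hl
      have i1 := mul_le_mul_of_nonneg_left
        (Real.binEntropy_le_log_two (p := s * (1 - p) + (1 - s) * p)) (by linarith : 0 ≤ 1 - u)
      have i2 := mul_le_mul_of_nonneg_left (Real.binEntropy_le_log_two (p := p)) hu0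
      simp only
      linarith
    · refine nonneg_of_mul_nonneg_left (b := Real.log 2) ?_ hl
      simp only
      rw [hB']
      refine mul_nonneg (by linarith) (le_trans ?_ hlow)
      have : 0 < 1 - Real.log 2 := by linarith
      positivity
    -- Sum rate: `A ≤ 1 - h p` by monotonicity, and `B * log 2 ≤ H(s/2)`, which `hH` puts below the
    -- gap left by the hypothesis on `p`.
    · refine le_of_mul_le_mul_right ?_ hl
      simp only
      have i1 := mul_le_mul_of_nonneg_left hDlo (by linarith : 0 ≤ 1 - u)
      have i2 : (1 - u) * (Real.binEntropy (s / 2) - s * Real.log 2) ≤ Real.binEntropy (s / 2) := by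
        have i3 := Real.binEntropy_nonneg (p := s / 2) (by linarith) (by linarith)
        have i4 := mul_nonneg hu0 i3
        have i5 := mul_nonneg (by linarith : 0 ≤ 1 - u) (mul_nonneg hspos.le hl.le)
        linarith
      have i6 := hb p
      linarith
  have hin := hW.innerBound_le hL0 hLag (hsub hmem)
  simp only at hin
  have hsE : Real.exp (-(3 * L * bscSlope p)) / 2 < s * (1 - Real.log 2) / 4 := by
    rw [div_lt_iff₀ (by linarith)] at hE
    -- The ratio `exp (-3 * L * c) / s` equals `exp 1 * exp (-L * c)`, which the choice of `L` makes
    -- small enough.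
    have hmul : Real.exp (-(3 * L * bscSlope p)) * (Real.exp (L * bscSlope p))
        = s * Real.exp 1 := by
      rw [hs, ← Real.exp_add, ← Real.exp_add]
      ring_nf
    have hE1 : 0 < Real.exp 1 := Real.exp_pos 1
    have := mul_lt_mul_of_pos_left hE (Real.exp_pos (-(3 * L * bscSlope p)))
    rw [← mul_assoc (Real.exp _) (Real.exp (L * _)), hmul] at this
    refine lt_of_mul_lt_mul_right ?_ hE1.le
    linarith
  have j1 := mul_le_mul_of_nonneg_left
    (mul_le_mul_of_nonneg_left hDhi (by linarith : 0 ≤ 1 - u)) hL0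
  have j2 := mul_le_mul_of_nonneg_left hlow (by linarith : 0 ≤ 1 - u)
  have j3 : 1 / 2 * (s * ((1 - Real.log 2) / 2)) ≤ (1 - u) * (s * ((1 - Real.log 2) / 2)) :=
    mul_le_mul_of_nonneg_right hu1 (mul_nonneg hspos.le (by linarith))
  have j4 : (L * A + B) * Real.log 2 = L * (A * Real.log 2) + B * Real.log 2 := by ring
  rw [j4, hA', hB'] at hin
  linarith

/-! ### The example `p = 1/4` and the conclusion -/

lemma one_sub_h_quarter_lt : 1 - h (1 / 4) < h (1 / 4) - 1 / 2 := by
  have hl : 0 < Real.log 2 := Real.log_pos one_lt_two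
  have h1 : Real.binEntropy (1 / 4) = 2 * Real.log 2 - 3 / 4 * Real.log 3 := by
    unfold Real.binEntropy
    rw [show ((1 : ℝ) / 4)⁻¹ = 2 ^ 2 by norm_num, show (1 - (1 : ℝ) / 4)⁻¹ = 2 ^ 2 / 3 by norm_num,
      Real.log_div (by norm_num) (by norm_num), Real.log_pow]
    push_cast
    ring
  -- `h (1/4) > 3/4` amounts to `log₂ 3 < 5/3`, that is, `27 < 32`.
  have h2 : 3 * Real.log 3 < 5 * Real.log 2 := by
    have := Real.log_lt_log (by norm_num) (show (3 : ℝ) ^ 3 < 2 ^ 5 by norm_num)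
    rw [Real.log_pow, Real.log_pow] at this
    exact_mod_cast this
  have h3 : 3 / 4 < h (1 / 4) := by
    unfold h
    rw [lt_div_iff₀ hl, h1]
    linarith
  linarith

end DegradedBC

theorem corollary2 :
    (1 - DegradedBC.h (1 / 4) < DegradedBC.h (1 / 4) - 1 / 2) ∧
    ∀ p : ℝ, 0 ≤ p → p < 1 / 2 → 1 - DegradedBC.h p < DegradedBC.h (1 / 4) - 1 / 2 →
      (∃ W : Fin 2 → Fin 2 × Fin 2 × Fin 2 → ℝ, DegradedBC.IsSkewSymmetricBSC p W) ∧
      ∀ W : Fin 2 → Fin 2 × Fin 2 × Fin 2 → ℝ, DegradedBC.IsSkewSymmetricBSC p W →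
        DegradedBC.innerBound W ⊂ DegradedBC.outerBound W ∧
        (∀ u ∈ Set.Icc (0 : ℝ) (1 / 2),
          (∃ q, DegradedBC.IsChoice u q) ∧
          ∀ q, DegradedBC.IsChoice u q →
            DegradedBC.regionAAt p u ⊆ DegradedBC.outerRegion W q) ∧
        DegradedBC.regionA p ⊆ DegradedBC.outerBound W ∧
        ¬ DegradedBC.regionA p ⊆ DegradedBC.innerBound W := by
  refine ⟨DegradedBC.one_sub_h_quarter_lt, fun p hp0 hp1 hp =>
    ⟨DegradedBC.exists_isSkewSymmetricBSC hp0 (by linarith), fun W hW => ?_⟩⟩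
  -- At `p = 0` the hypothesis would read `h (1/4) > 3/2`, but binary entropy is at most one bit.
  have hpos : 0 < p := by
    refine hp0.lt_of_ne ?_
    rintro rfl
    have : DegradedBC.h (1 / 4) ≤ 1 :=
      (div_le_one (Real.log_pos one_lt_two)).2 Real.binEntropy_le_log_two
    have h0 : DegradedBC.h 0 = 0 := by simp [DegradedBC.h]
    linarith
  have hnot := hW.not_regionA_subset hpos hp1 hp
  have hchoice : ∀ u ∈ Set.Icc (0 : ℝ) (1 / 2), ∃ q, DegradedBC.IsChoice u q :=
    fun u hu => DegradedBC.exists_isChoice hu.1 hu.2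
  have hout : DegradedBC.regionA p ⊆ DegradedBC.outerBound W := by
    refine Set.iUnion₂_subset fun u hu R hR => ?_
    obtain ⟨q, hq⟩ := hchoice u hu
    exact ⟨2, 2, q, hq.mem, hW.regionAAt_subset hu.2 hq hR⟩
  exact ⟨⟨DegradedBC.innerBound_subset_outerBound W, fun hsub => hnot (hout.trans hsub)⟩,
    fun u hu => ⟨hchoice u hu, fun q hq => hW.regionAAt_subset hu.2 hq⟩, hout, hnot⟩
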